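/- **Setting.** A quasi $*$-algebra $(\mathfrak A,\mathfrak A_0)$ is a complex vector space $\mathfrak A$ with involution containing a $*$-algebra $\mathfrak A_0$ (not necessarily unital) as a subspace, such that $\mathfrak A$ is an $\mathfrak A_0$-bimodule, the involution and the module products extend those of $\mathfrak A_0$, $(xa)y=x(ay)$, $a(xy)=(ax)y$ and $(ax)^*=x^*a^*$ for $a\in\mathfrak A$, $x,y\in\mathfrak A_0$. It is a Banach quasi $*$-algebra if $\mathfrak A$ is a Banach space with $\|a^*\|=\|a\|$, $\mathfrak A_0$ is norm dense in $\mathfrak A$, and $a\mapsto ax$ is continuous for each $x\in\mathfrak A_0$. Let $\mathcal S$ be the set of sesquilinear forms $\varphi$ on $\mathfrak A\times\mathfrak A$ (linear in the first variable) with $\varphi(a,a)\ge 0$, $\varphi(ax,y)=\varphi(x,a^*y)$ and $|\varphi(a,b)|\le\|a\|\|b\|$ for all $a,b\in\mathfrak A$, $x,y\in\mathfrak A_0$. $(\mathfrak A,\mathfrak A_0)$ is $*$-semisimple if $\varphi(a,a)=0$ for all $\varphi\in\mathcal S$ implies $a=0$. The weak product $a\,\square\,b$ is well defined and equal to $c\in\mathfrak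 A$ if $\varphi(bx,a^*y)=\varphi(cx,y)$ for all $\varphi\in\mathcal S$, $x,y\in\mathfrak A_0$. An element $a\in\mathfrak A$ is bounded if $x\mapsto ax$ and $x\mapsto xa$ are continuous from $(\mathfrak A_0,\|\cdot\|)$ to $\mathfrak A$. Let $\hat L_a b=a\,\square\,b$, on the set of all $b$ for which $a\,\square\,b$ is well defined; $\mathfrak A_0$ is a core for $\hat L_a$ if the graph of $\hat L_a$ is the closure in $\mathfrak A\times\mathfrak A$ of $\{(x,ax):x\in\mathfrak A_0\}$. A weak $*$-derivation is a linear map $\delta:\mathcal D(\delta)\to\mathfrak A$, where $\mathcal D(\delta)\subseteq\mathfrak A$ is a $*$-invariant subspace containing $\mathfrak A_0$, such that $\delta(x^*)=\delta(x)^*$ for $x\in\mathfrak A_0$ and, whenever $a,b\in\mathcal D(\delta)$ and $a\,\square\,b$ is well defined, $a\,\square\,b\in\mathcal D(\delta)$ and $\varphi(\delta(a\,\square\,b)x,y)=\varphi(bx,\delta(a)^*y)+\varphi(\delta(b)x,a^*y)$ for all $\varphi\in\mathcal S$, $x,y\in\mathfrak A_0$. A weak $*$-automorphism is a linear bijection $\theta$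 of $\mathfrak A$ with $\theta(a^*)=\theta(a)^*$ such that $\theta(a)\,\square\,\theta(b)$ is well defined if and only if $a\,\square\,b$ is, and then $\theta(a\,\square\,b)=\theta(a)\,\square\,\theta(b)$. **Theorem.** Let $(\mathfrak A,\mathfrak A_0)$ be a $*$-semisimple Banach quasi $*$-algebra and let $\delta$ be a closed weak $*$-derivation all of whose domain consists of bounded elements. Suppose that every $\lambda\in\mathbb R\setminus\{0\}$ belongs to the resolvent set of $\delta$ (that is, $\lambda I-\delta$ is a bijection of $\mathcal D(\delta)$ onto $\mathfrak A$ with bounded inverse), that $$\|\delta(a)-\lambda a\|\ge|\lambda|\,\|a\|\qquad(a\in\mathcal D(\delta),\ \lambda\in\mathbb R),$$ and that $\mathfrak A_0$ is a core for $\hat L_a$ for every $a\in\mathfrak A$. Then there are weak $*$-automorphisms $\beta_t$ $(t\in\mathbb R)$ of $(\mathfrak A,\mathfrak A_0)$ with $\beta_0=I$ and $\beta_{t+s}=\beta_t\beta_s$, such that 1. for some $M$, $\|\beta_t(a)\|\le M\|a\|$ for all $t\in\mathbb R$, $a\in\mathfrak A$; 2. $t\mapsto\beta_t(a)$ is norm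 continuous for every $a\in\mathfrak A$; 3. $\delta$ is the infinitesimal generator of $(\beta_t)$: $\mathcal D(\delta)$ is the set of all $a$ for which the norm limit $\lim_{t\to0}(\beta_t(a)-a)/t$ exists, and $\delta(a)$ is this limit; 4. for every $t\ne0$ and every $n\ge1$ the operator $I-\frac tn\delta$ is a bijection of $\mathcal D(\delta)$ onto $\mathfrak A$ with bounded inverse, and $\beta_t(a)=\lim_{n\to\infty}\bigl(I-\frac tn\delta\bigr)^{-n}(a)$ in norm for every $a\in\mathfrak A$. -/

import Mathlib

open Filter Topology

/-- A quasi *-algebra `(A, A₀)`: the *-algebra `A₀` (associative, not necessarily unital) sits in the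
complex vector space with involution `A` through the injective linear map `incl`, and `A` is an
`A₀`-bimodule. The left module product `x a` is `lmul x a`, the right one `a x` is `rmul a x`; both
extend the product of `A₀`, and the involution of `A` extends that of `A₀`. -/
structure QuasiStarAlgebra (A₀ A : Type*)
    [NonUnitalRing A₀] [Module ℂ A₀] [IsScalarTower ℂ A₀ A₀] [SMulCommClass ℂ A₀ A₀]
    [StarRing A₀] [StarModule ℂ A₀]
    [AddCommGroup A] [Module ℂ A] [StarAddMonoid A] [StarModule ℂ A] where
  incl : A₀ →ₗ[ℂ] A
  incl_injective : Function.Injective incl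
  incl_star : ∀ x, incl (star x) = star (incl x)
  lmul : A₀ →ₗ[ℂ] A →ₗ[ℂ] A
  rmul : A →ₗ[ℂ] A₀ →ₗ[ℂ] A
  lmul_incl : ∀ x y, lmul x (incl y) = incl (x * y)
  rmul_incl : ∀ x y, rmul (incl x) y = incl (x * y)
  lmul_mul : ∀ x y a, lmul (x * y) a = lmul x (lmul y a)
  rmul_mul : ∀ a x y, rmul a (x * y) = rmul (rmul a x) y
  lmul_rmul : ∀ x a y, rmul (lmul x a) y = lmul x (rmul a y)
  star_rmul : ∀ a x, star (rmul a x) = lmul (star x) (star a)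

/-- A Banach quasi *-algebra: `A` is a Banach space with isometric involution (these two properties
are the instances `CompleteSpace A` and `NormedStarGroup A`), `A₀` is dense in `A`, and `a ↦ a x` is
continuous for every `x` in `A₀`. -/
structure BanachQuasiStarAlgebra (A₀ A : Type*)
    [NonUnitalRing A₀] [Module ℂ A₀] [IsScalarTower ℂ A₀ A₀] [SMulCommClass ℂ A₀ A₀]
    [StarRing A₀] [StarModule ℂ A₀]
    [NormedAddCommGroup A] [NormedSpace ℂ A] [CompleteSpace A]
    [StarAddMonoid A] [StarModule ℂ A] [NormedStarGroup A]
    extends QuasiStarAlgebra A₀ A where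
  dense_incl : DenseRange incl
  continuous_rmul : ∀ x, Continuous fun a => rmul a x

namespace BanachQuasiStarAlgebra

variable {A₀ A : Type*}
  [NonUnitalRing A₀] [Module ℂ A₀] [IsScalarTower ℂ A₀ A₀] [SMulCommClass ℂ A₀ A₀]
  [StarRing A₀] [StarModule ℂ A₀]
  [NormedAddCommGroup A] [NormedSpace ℂ A] [CompleteSpace A]
  [StarAddMonoid A] [StarModule ℂ A] [NormedStarGroup A]

/-- The family of positive invariant sesquilinear forms on `A × A` (linear in the first variable,
conjugate linear in the second one) that are bounded by one. -/
def forms (Q : BanachQuasiStarAlgebra A₀ A) : Set (A →ₗ[ℂ] A →ₗ⋆[ℂ] ℂ) :=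
  {φ | (∀ a, 0 ≤ (φ a a).re ∧ (φ a a).im = 0) ∧
    (∀ a x y, φ (Q.rmul a x) (Q.incl y) = φ (Q.incl x) (Q.rmul (star a) y)) ∧
    ∀ a b, ‖φ a b‖ ≤ ‖a‖ * ‖b‖}

def StarSemisimple (Q : BanachQuasiStarAlgebra A₀ A) : Prop :=
  ∀ a : A, (∀ φ ∈ Q.forms, φ a a = 0) → a = 0

/-- `c` is the weak product of `a` and `b`. The weak product of `a` and `b` is well defined if
such a `c` exists. -/
def IsWeakMul (Q : BanachQuasiStarAlgebra A₀ A) (a b c : A) : Prop :=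
  ∀ φ ∈ Q.forms, ∀ x y : A₀, φ (Q.rmul b x) (Q.rmul (star a) y) = φ (Q.rmul c x) (Q.incl y)

/-- `a` is bounded: `x ↦ a x` and `x ↦ x a` are norm continuous from `A₀`, with the norm of `A`,
to `A`. -/
def IsBoundedElement (Q : BanachQuasiStarAlgebra A₀ A) (a : A) : Prop :=
  (∃ C : ℝ, ∀ x, ‖Q.rmul a x‖ ≤ C * ‖Q.incl x‖) ∧ ∃ C : ℝ, ∀ x, ‖Q.lmul x a‖ ≤ C * ‖Q.incl x‖

/-- The graph of `L_a : A₀ → A`, `x ↦ a x`, in `A × A`. -/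
def leftMulGraph (Q : BanachQuasiStarAlgebra A₀ A) (a : A) : Set (A × A) :=
  Set.range fun x : A₀ => (Q.incl x, Q.rmul a x)

/-- The graph of the weak left multiplication by `a`, defined at all `b` for which the weak product
of `a` and `b` is well defined. -/
def weakLeftMulGraph (Q : BanachQuasiStarAlgebra A₀ A) (a : A) : Set (A × A) :=
  {p | Q.IsWeakMul a p.1 p.2}

/-- `A₀` is a core for the weak left multiplication by `a`: the latter is the closure of its
restriction `L_a` to `A₀`. -/
def IsCoreForLeftMul (Q : BanachQuasiStarAlgebra A₀ A) (a : A) : Prop :=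
  Q.weakLeftMulGraph a = closure (Q.leftMulGraph a)

/-- Weak *-derivations, with domain a partial *-algebra for the weak multiplication. -/
structure IsWeakStarDerivation (Q : BanachQuasiStarAlgebra A₀ A) (δ : A →ₗ.[ℂ] A) : Prop where
  star_mem : ∀ a ∈ δ.domain, star a ∈ δ.domain
  incl_mem : ∀ x, Q.incl x ∈ δ.domain
  map_star : ∀ x, δ ⟨Q.incl (star x), incl_mem (star x)⟩ = star (δ ⟨Q.incl x, incl_mem x⟩)
  leibniz : ∀ (a b : δ.domain) (c : A), Q.IsWeakMul a b c → ∃ hc : c ∈ δ.domain,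
    ∀ φ ∈ Q.forms, ∀ x y : A₀, φ (Q.rmul (δ ⟨c, hc⟩) x) (Q.incl y) =
      φ (Q.rmul b x) (Q.rmul (star (δ a)) y) + φ (Q.rmul (δ b) x) (Q.rmul (star (a : A)) y)

/-- Weak *-automorphisms; the last two fields say that the weak product of `θ a` and `θ b` is well
defined iff that of `a` and `b` is, and that `θ` then maps the latter to the former. -/
structure IsWeakStarAutomorphism (Q : BanachQuasiStarAlgebra A₀ A) (θ : A ≃ₗ[ℂ] A) : Prop where
  map_star : ∀ a, θ (star a) = star (θ a)
  exists_iff : ∀ a b, (∃ c, Q.IsWeakMul (θ a) (θ b) c) ↔ ∃ c, Q.IsWeakMul a b c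
  map_weakMul : ∀ a b c, Q.IsWeakMul a b c → Q.IsWeakMul (θ a) (θ b) (θ c)

/-- One-parameter groups of weak *-automorphisms. -/
structure IsWeakStarAutomorphismGroup (Q : BanachQuasiStarAlgebra A₀ A)
    (β : ℝ → A ≃ₗ[ℂ] A) : Prop where
  isWeakStarAutomorphism : ∀ t, Q.IsWeakStarAutomorphism (β t)
  map_zero : ∀ a, β 0 a = a
  map_add : ∀ t s a, β (t + s) a = β t (β s a)

end BanachQuasiStarAlgebra

section Operators

variable {E : Type*} [NormedAddCommGroup E] [NormedSpace ℂ E]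

/-- The everywhere defined bounded operator `R` is the inverse of `c I - s T`, whose domain is the
domain of `T`. -/
def IsBoundedInverse (T : E →ₗ.[ℂ] E) (c s : ℂ) (R : E →L[ℂ] E) : Prop :=
  (∀ a : E, ∃ h : R a ∈ T.domain, c • R a - s • T ⟨R a, h⟩ = a) ∧
    ∀ a : T.domain, R (c • (a : E) - s • T a) = a

/-- The resolvent set of a linear operator. -/
def operatorResolventSet (T : E →ₗ.[ℂ] E) : Set ℂ :=
  {z | ∃ R : E →L[ℂ] E, IsBoundedInverse T z 1 R}

/-- `T` is the infinitesimal generator of `β` in the norm topology: its domain consists of all `a`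
for which `(β t a - a) / t` converges as `t → 0`, and `T a` is the limit. -/
def IsInfinitesimalGenerator (T : E →ₗ.[ℂ] E) (β : ℝ → E ≃ₗ[ℂ] E) : Prop :=
  ∀ a b : E, (∃ h : a ∈ T.domain, T ⟨a, h⟩ = b) ↔
    Tendsto (fun t : ℝ => (t : ℂ)⁻¹ • (β t a - a)) (𝓝[≠] 0) (𝓝 b)

end Operators

/-! By the lower bound at `r = 1/t`, the resolvents `J t = (1 - t δ)⁻¹` are contractions for both
signs of `t`. The exponential formula therefore produces a group `S` of contractions, hence
isometries, generated by `δ` (`cauchySeq_pow`, `add_apply`, `mem_graph_iff_tendsto`). Involution: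
`map_star` concerns only `A₀`, which is dense but not assumed to be a core of `δ`. Norming
functionals show that `δ` and its conjugate by `star` still agree on the whole domain
(`graph_star`). Product: domain elements are bounded, so `B u b = (J 1 u) □ b` is a continuous
bilinear map. By the Leibniz rule `s ↦ S (-s) (B (S s u) (S s b))` is constant for `u`, `b` in the
domain. This gives `S t (a x) = S t a □ S t x` first for `a` in the domain of `δ²`, then for all `a`
because the weak product relation is closed; the core hypothesis passes from `x` in `A₀` to
arbitrary factors. -/

section Generation

variable {E : Type*} [NormedAddCommGroup E] [NormedSpace ℂ E]

/-! ### Powers of contractions. -/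

theorem norm_pow_apply_le {P : E →L[ℂ] E} (hP : ∀ a, ‖P a‖ ≤ ‖a‖) (n : ℕ) (a : E) :
    ‖(P ^ n) a‖ ≤ ‖a‖ := by
  induction n generalizing a with
  | zero => simp
  | succ k ih => rw [pow_succ]; exact (ih (P a)).trans (hP a)

/-- Commuting contractions satisfy `‖P ^ n a - Q ^ n a‖ ≤ n ‖P a - Q a‖`. -/
theorem norm_pow_sub_pow_apply_le {P Q : E →L[ℂ] E} (hP : ∀ a, ‖P a‖ ≤ ‖a‖)
    (hQ : ∀ a, ‖Q a‖ ≤ ‖a‖) (hPQ : Commute P Q) (n : ℕ) (a : E) :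
    ‖(P ^ n) a - (Q ^ n) a‖ ≤ n * ‖P a - Q a‖ := by
  induction n with
  | zero => simp
  | succ n ih =>
    have h1 : (P ^ n) (Q a) = Q ((P ^ n) a) := congrArg (fun T : E →L[ℂ] E => T a) (hPQ.pow_left n)
    have h2 : (P ^ (n + 1)) a - (Q ^ (n + 1)) a
        = (P ^ n) (P a - Q a) + Q ((P ^ n) a - (Q ^ n) a) := by
      rw [pow_succ, pow_succ' Q, map_sub, map_sub, h1]
      simp
    rw [h2, Nat.cast_succ]
    linarith [norm_add_le ((P ^ n) (P a - Q a)) (Q ((P ^ n) a - (Q ^ n) a)),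
      norm_pow_apply_le hP n (P a - Q a),
      hQ ((P ^ n) a - (Q ^ n) a)]

/-- Uniform boundedness plus convergence on a dense set; it serves both the resolvents and the
group. -/
theorem tendsto_apply_zero_of_graph {T : E →ₗ.[ℂ] E} (hT : Dense (T.domain : Set E))
    {P : ℝ → E →L[ℂ] E} (hP : ∀ t a, ‖P t a‖ ≤ ‖a‖)
    (hPT : ∀ a b, (a, b) ∈ T.graph → ∀ t, ‖P t a - a‖ ≤ |t| * ‖b‖) (a : E) :
    Tendsto (fun t => P t a) (𝓝 0) (𝓝 a) := by
  rw [Metric.tendsto_nhds]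
  intro ε hε
  obtain ⟨a', ha, hd⟩ := Metric.dense_iff.1 hT a (ε / 4) (by positivity)
  rw [Metric.mem_ball, dist_eq_norm, norm_sub_rev] at ha
  have h2 : Tendsto (fun t : ℝ => |t| * ‖T ⟨a', hd⟩‖) (𝓝 0) (𝓝 0) := by
    have : Continuous fun t : ℝ => |t| * ‖T ⟨a', hd⟩‖ := by fun_prop
    simpa using this.tendsto 0
  filter_upwards [h2.eventually_lt_const (show 0 < ε / 4 by positivity)] with t ht
  have h3 := hPT _ _ (T.mem_graph ⟨a', hd⟩) t
  have h4 := hP t (a - a')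
  have h5 : P t a - a = P t (a - a') + (P t a' - a') - (a - a') := by rw [map_sub]; abel
  rw [dist_eq_norm, h5]
  have h6 := norm_sub_le (P t (a - a') + (P t a' - a')) (a - a')
  have h7 := norm_add_le (P t (a - a')) (P t a' - a')
  simp only at h3
  linarith

/-- `T` is densely defined, `J t = (1 - t T)⁻¹` is a contraction for every real `t ≠ 0`, and
`J 0 = 1`. -/
structure IsContractiveResolvent (T : E →ₗ.[ℂ] E) (J : ℝ → E →L[ℂ] E) : Prop where
  isBoundedInverse : ∀ t : ℝ, t ≠ 0 → IsBoundedInverse T 1 (t : ℂ) (J t)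
  norm_le : ∀ t a, ‖J t a‖ ≤ ‖a‖
  dense : Dense (T.domain : Set E)
  zero_apply : ∀ a, J 0 a = a

/-! ### Resolvent estimates and convergence of the exponential formula. -/

namespace IsContractiveResolvent

variable {T : E →ₗ.[ℂ] E} {J : ℝ → E →L[ℂ] E}

theorem apply_of_graph (h : IsContractiveResolvent T J) {a b : E} (hab : (a, b) ∈ T.graph) (t : ℝ) :
    J t a - a = (t : ℂ) • J t b := by
  rcases eq_or_ne t 0 with rfl | ht
  · simp [h.zero_apply]
  obtain ⟨y, rfl, rfl⟩ := (T.mem_graph_iff).1 hab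
  have h1 := (h.isBoundedInverse t ht).2 y
  simp only [one_smul, map_sub, map_smul] at h1
  nth_rewrite 2 [← h1]
  abel

theorem exists_graph (h : IsContractiveResolvent T J) {t : ℝ} (ht : t ≠ 0) (a : E) :
    ∃ b, (J t a, b) ∈ T.graph ∧ J t a - (t : ℂ) • b = a := by
  obtain ⟨h1, h2⟩ := (h.isBoundedInverse t ht).1 a
  exact ⟨T ⟨J t a, h1⟩, T.mem_graph ⟨J t a, h1⟩, by simpa using h2⟩

theorem map_graph (h : IsContractiveResolvent T J) {a b : E} (hab : (a, b) ∈ T.graph) (t : ℝ) :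
    (J t a, J t b) ∈ T.graph := by
  rcases eq_or_ne t 0 with rfl | ht
  · simpa [h.zero_apply] using hab
  · obtain ⟨c, hc, hc'⟩ := h.exists_graph ht a
    have h1 := h.apply_of_graph hab t
    have h2 : c = J t b := by
      refine smul_right_injective E (r := (t : ℂ)) (by exact_mod_cast ht) ?_
      change (t : ℂ) • c = (t : ℂ) • J t b
      rw [← h1, eq_sub_iff_add_eq, add_comm]
      exact (sub_eq_iff_eq_add.1 hc').symm
    rwa [← h2]

theorem eq_apply (h : IsContractiveResolvent T J) {a b : E} (hab : (a, b) ∈ T.graph) (t : ℝ) : J t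
    (a - (t : ℂ) • b) = a := by
  rw [map_sub, map_smul, ← h.apply_of_graph hab t]
  abel

theorem commute (h : IsContractiveResolvent T J) (s t : ℝ) : Commute (J s) (J t) := by
  ext a
  rcases eq_or_ne s 0 with rfl | hs
  · simp [h.zero_apply]
  obtain ⟨d, hd, hd'⟩ := h.exists_graph hs a
  have h1 := h.eq_apply (h.map_graph hd t) s
  rw [← map_smul, ← map_sub, hd'] at h1
  exact h1

theorem norm_pow_le (h : IsContractiveResolvent T J) (t : ℝ) (n : ℕ) (a : E) :
    ‖(J t ^ n) a‖ ≤ ‖a‖ :=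
  norm_pow_apply_le (h.norm_le t) n a

theorem norm_pow_sub_le (h : IsContractiveResolvent T J) {a b : E} (hab : (a, b) ∈ T.graph) (t :
    ℝ) (m : ℕ) :
    ‖(J t ^ m) a - a‖ ≤ m * |t| * ‖b‖ := by
  have h1 := norm_pow_sub_pow_apply_le (h.norm_le t) (Q := 1) (by simp) (Commute.one_right _) m a
  simp only [one_pow, one_apply_eq_self] at h1
  rw [h.apply_of_graph hab t, norm_smul, Complex.norm_real, Real.norm_eq_abs] at h1
  rw [mul_assoc]
  exact h1.trans (by gcongr; exact h.norm_le t b)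

/-- A second-order Taylor bound for `a` in the domain of `T²`. The induction closes because `m² + m
+ 1 ≤ (m + 1)²`. -/
theorem norm_pow_sub_sub_le (h : IsContractiveResolvent T J) {a b c : E} (hab : (a, b) ∈ T.graph)
    (hbc : (b, c) ∈ T.graph) (t : ℝ) (m : ℕ) :
    ‖(J t ^ m) a - a - ((m * t : ℝ) : ℂ) • b‖ ≤ (m * t) ^ 2 * ‖c‖ := by
  induction m with
  | zero => simp
  | succ m ih =>
    have h1 : ‖J t b - b‖ ≤ |t| * ‖c‖ := by simpa using h.norm_pow_sub_le hbc t 1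
    have h2 := h.norm_pow_sub_le hbc t m
    have h3 := h.norm_pow_le t m (J t b - b)
    have h4 : (J t ^ (m + 1)) a - a - (((m + 1 : ℕ) * t : ℝ) : ℂ) • b
        = (t : ℂ) • (J t ^ m) (J t b - b) + ((J t ^ m) a - a - ((m * t : ℝ) : ℂ) • b)
          + (t : ℂ) • ((J t ^ m) b - b) := by
      have h5 : J t a = a + (t : ℂ) • J t b := by rw [← h.apply_of_graph hab t]; abel
      rw [pow_succ, mul_apply_eq_comp, h5]
      simp only [map_add, map_smul, map_sub]
      push_cast
      module
    rw [h4]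
    have h6 : ‖(t : ℂ) • (J t ^ m) (J t b - b)‖ ≤ |t| * (|t| * ‖c‖) := by
      rw [norm_smul, Complex.norm_real, Real.norm_eq_abs]
      gcongr
      exact h3.trans h1
    have h7 : ‖(t : ℂ) • ((J t ^ m) b - b)‖ ≤ |t| * (m * |t| * ‖c‖) := by
      rw [norm_smul, Complex.norm_real, Real.norm_eq_abs]
      gcongr
    have h8 : |t| * |t| = t ^ 2 := by rw [← sq, sq_abs]
    have h9 : |t| * (|t| * ‖c‖) = t ^ 2 * ‖c‖ := by rw [← h8]; ring
    have h10 : |t| * (m * |t| * ‖c‖) = m * (t ^ 2 * ‖c‖) := by rw [← h8]; ring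
    have h11 : (0 : ℝ) ≤ m * (t ^ 2 * ‖c‖) := by positivity
    refine (norm_add₃_le).trans ?_
    rw [Nat.cast_succ]
    nlinarith

theorem dense_sq (h : IsContractiveResolvent T J) : Dense {a : E | ∃ b c, (a, b) ∈ T.graph ∧ (b,
    c) ∈ T.graph} := by
  have h1 : DenseRange (J 1) := by
    refine h.dense.mono fun a ha => ?_
    exact ⟨_, h.eq_apply (T.mem_graph ⟨a, ha⟩) 1⟩
  -- The range of `J 1 * J 1` is dense and lies in the domain of `T²`.
  refine (h1.comp h1 (J 1).continuous).mono ?_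
  rintro _ ⟨z, rfl⟩
  obtain ⟨b, hb, hb'⟩ := h.exists_graph one_ne_zero z
  refine ⟨J 1 b, J 1 b - b, h.map_graph hb 1, ?_⟩
  obtain ⟨c, hc, hc'⟩ := h.exists_graph one_ne_zero b
  have h3 : J 1 b - b = c := by
    nth_rewrite 2 [← hc']
    simp
  rwa [h3]

/-- One step of length `t / n` and `m` steps of length `t / (n m)` have the same first-order
expansion, so they differ by `O(n⁻²)`; taking `n`-th powers costs a factor `n`. -/
theorem norm_pow_sub_pow_mul_le (h : IsContractiveResolvent T J) {a b c : E}
    (hab : (a, b) ∈ T.graph) (hbc : (b, c) ∈ T.graph) (t : ℝ) {n m : ℕ} (hn : n ≠ 0) (hm : m ≠ 0) :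
    ‖(J (t / n) ^ n) a - (J (t / (n * m : ℕ)) ^ (n * m)) a‖ ≤ 2 * t ^ 2 * ‖c‖ / n := by
  have hn' : (n : ℝ) ≠ 0 := by exact_mod_cast hn
  have hm' : (m : ℝ) ≠ 0 := by exact_mod_cast hm
  have h1 := norm_pow_sub_pow_apply_le (h.norm_le (t / n)) (h.norm_pow_le (t / (n * m : ℕ)) m)
    ((h.commute _ _).pow_right m) n a
  rw [← pow_mul, mul_comm m n] at h1
  have h2 := h.norm_pow_sub_sub_le hab hbc (t / n) 1
  have h3 := h.norm_pow_sub_sub_le hab hbc (t / (n * m : ℕ)) m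
  have e : (m : ℝ) * (t / (n * m : ℕ)) = t / n := by push_cast; field_simp
  rw [e] at h3
  simp only [Nat.cast_one, one_mul, pow_one] at h2
  have h4 : ‖J (t / n) a - (J (t / (n * m : ℕ)) ^ m) a‖ ≤ 2 * ((t / n) ^ 2 * ‖c‖) := by
    have := norm_sub_le (J (t / n) a - a - ((t / n : ℝ) : ℂ) • b)
      ((J (t / (n * m : ℕ)) ^ m) a - a - ((t / n : ℝ) : ℂ) • b)
    rw [sub_sub_sub_cancel_right, sub_sub_sub_cancel_right] at this
    linarith
  refine h1.trans ((mul_le_mul_of_nonneg_left h4 (Nat.cast_nonneg n)).trans (le_of_eq ?_))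
  field_simp

theorem cauchySeq_pow (h : IsContractiveResolvent T J) [CompleteSpace E] (t : ℝ) (a : E) :
    CauchySeq fun n : ℕ => (J (t / n) ^ n) a := by
  rw [Metric.cauchySeq_iff']
  intro ε hε
  obtain ⟨a', ha', b, c, hab, hbc⟩ := Metric.dense_iff.1 h.dense_sq a (ε / 8) (by positivity)
  rw [Metric.mem_ball, dist_comm] at ha'
  have h1 : Tendsto (fun n : ℕ => 2 * t ^ 2 * ‖c‖ / n) atTop (𝓝 0) :=
    tendsto_const_div_atTop_nhds_zero_nat _
  obtain ⟨N, hN⟩ := eventually_atTop.1 ((h1.eventually_lt_const (show 0 < ε / 8 by positivity)).and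
    (eventually_ne_atTop 0))
  have key : ∀ n : ℕ, ∀ a'', dist ((J (t / n) ^ n) a) ((J (t / n) ^ n) a'') ≤ dist a a'' := by
    intro n a''
    rw [dist_eq_norm, dist_eq_norm, ← map_sub]
    exact h.norm_pow_le _ _ _
  refine ⟨N, fun n hn => ?_⟩
  -- The indices `n` and `N` are compared through their common refinement `n * N`.
  have e1 := h.norm_pow_sub_pow_mul_le hab hbc t (hN n hn).2 (hN N le_rfl).2
  have e2 := h.norm_pow_sub_pow_mul_le hab hbc t (hN N le_rfl).2 (hN n hn).2
  rw [mul_comm N n] at e2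
  have e3 := (hN n hn).1
  have e4 := (hN N le_rfl).1
  have k1 := key n a'
  have k2 := key N a'
  rw [← dist_eq_norm] at e1 e2
  have := dist_triangle4 ((J (t / n) ^ n) a) ((J (t / n) ^ n) a') ((J (t / N) ^ N) a')
    ((J (t / N) ^ N) a)
  have h5 := dist_triangle_right ((J (t / n) ^ n) a') ((J (t / N) ^ N) a')
    ((J (t / (n * N : ℕ)) ^ (n * N)) a')
  rw [dist_comm ((J (t / N) ^ N) a') ((J (t / N) ^ N) a)] at this
  linarith

end IsContractiveResolvent

/-- `S t` is the strong limit of the powers `(1 - (t / n) T) ^ (-n)`. -/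
def IsExponentialLimit (J S : ℝ → E →L[ℂ] E) : Prop :=
  ∀ t a, Tendsto (fun n : ℕ => (J (t / n) ^ n) a) atTop (𝓝 (S t a))

theorem IsContractiveResolvent.exists_isExponentialLimit [CompleteSpace E] {T : E →ₗ.[ℂ] E}
    {J : ℝ → E →L[ℂ] E} (h : IsContractiveResolvent T J) : ∃ S, IsExponentialLimit J S := by
  have h1 : ∀ t : ℝ, ∃ S : E →L[ℂ] E,
      ∀ a, Tendsto (fun n : ℕ => (J (t / n) ^ n) a) atTop (𝓝 (S a)) := by
    intro t
    choose f hf using fun a => cauchySeq_tendsto_of_complete (h.cauchySeq_pow t a)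
    let L : E →ₗ[ℂ] E := linearMapOfTendsto f (fun n : ℕ => ((J (t / n) ^ n : E →L[ℂ] E) :
    E →ₗ[ℂ] E))
      (tendsto_pi_nhds.2 hf)
    refine ⟨L.mkContinuous 1 fun a => ?_, fun a => hf a⟩
    rw [one_mul]
    exact le_of_tendsto (hf a).norm (Eventually.of_forall fun n => h.norm_pow_le _ _ _)
  choose S hS using h1
  exact ⟨S, hS⟩

/-- Strong limits of contractions are compatible with composition. -/
theorem tendsto_mul_apply {ι : Type*} {l : Filter ι} {P Q : ι → E →L[ℂ] E} {P' Q' : E →L[ℂ] E}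
    (hP : ∀ i a, ‖P i a‖ ≤ ‖a‖) (h1 : ∀ a, Tendsto (fun i => P i a) l (𝓝 (P' a)))
    (h2 : ∀ a, Tendsto (fun i => Q i a) l (𝓝 (Q' a))) (a : E) :
    Tendsto (fun i => (P i * Q i) a) l (𝓝 ((P' * Q') a)) := by
  have h3 : Tendsto (fun i => P i (Q i a - Q' a)) l (𝓝 0) := by
    refine squeeze_zero_norm (fun i => hP i _) ?_
    simpa using ((h2 a).sub_const (Q' a)).norm
  simpa using h3.add (h1 (Q' a))

theorem tendsto_pow_apply {ι : Type*} {l : Filter ι} {P : ι → E →L[ℂ] E} {P' : E →L[ℂ] E}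
    (hP : ∀ i a, ‖P i a‖ ≤ ‖a‖) (h1 : ∀ a, Tendsto (fun i => P i a) l (𝓝 (P' a))) (n : ℕ) (a : E) :
    Tendsto (fun i => (P i ^ n) a) l (𝓝 ((P' ^ n) a)) := by
  induction n generalizing a with
  | zero => simpa using tendsto_const_nhds
  | succ n ih =>
    simp only [pow_succ]
    exact tendsto_mul_apply (fun i => norm_pow_apply_le (hP i) n) ih h1 a

/-! ### The limit group and its generator. -/

namespace IsExponentialLimit

variable {T : E →ₗ.[ℂ] E} {J S : ℝ → E →L[ℂ] E}

theorem norm_le (hS : IsExponentialLimit J S)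
    (h : IsContractiveResolvent T J) (t : ℝ) (a : E) : ‖S t a‖ ≤ ‖a‖ :=
  le_of_tendsto (hS t a).norm (Eventually.of_forall fun _ => h.norm_pow_le _ _ _)

theorem zero_apply (hS : IsExponentialLimit J S)
    (h : IsContractiveResolvent T J) (a : E) : S 0 a = a := by
  refine tendsto_nhds_unique (hS 0 a) ?_
  have h1 : J 0 = 1 := by ext b; exact h.zero_apply b
  simp [h1]

theorem commute_resolvent (hS : IsExponentialLimit J S)
    (h : IsContractiveResolvent T J) (s t : ℝ) : Commute (J s) (S t) := by
  ext a
  refine tendsto_nhds_unique ((J s).continuous.continuousAt.tendsto.comp (hS t a)) ?_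
  refine (hS t (J s a)).congr fun n => ?_
  exact congrArg (fun T : E →L[ℂ] E => T a) ((h.commute (t / n) s).pow_left n)

theorem commute (hS : IsExponentialLimit J S)
    (h : IsContractiveResolvent T J) (s t : ℝ) : Commute (S s) (S t) := by
  ext a
  refine tendsto_nhds_unique (hS s (S t a)) ?_
  refine ((S t).continuous.continuousAt.tendsto.comp (hS s a)).congr fun n => ?_
  exact (congrArg (fun T : E →L[ℂ] E => T a) ((hS.commute_resolvent h (s / n) t).pow_left n)).symm

/-- The graph consists of the pairs with `J 1 (a - b) = a`, so commuting with `J 1` is enough. -/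
theorem map_graph (hS : IsExponentialLimit J S)
    (h : IsContractiveResolvent T J) {a b : E} (hab : (a, b) ∈ T.graph) (t : ℝ) : (S t a,
    S t b) ∈ T.graph := by
  have h1 := h.eq_apply hab 1
  obtain ⟨c, hc, hc'⟩ := h.exists_graph one_ne_zero (S t (a - b))
  have h2 : J 1 (S t (a - b)) = S t a := by
    have := congrArg (fun T : E →L[ℂ] E => T (a - b)) (hS.commute_resolvent h 1 t)
    simp only [mul_apply_eq_comp] at this
    rw [this]
    simpa using congrArg (S t) h1
  rw [h2] at hc hc'
  have h3 : c = S t b := by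
    simp only [Complex.ofReal_one, one_smul, map_sub] at hc'
    exact sub_right_injective hc'
  rwa [← h3]

theorem norm_sub_le (hS : IsExponentialLimit J S)
    (h : IsContractiveResolvent T J) {a b : E} (hab : (a, b) ∈ T.graph) (t : ℝ) :
    ‖S t a - a‖ ≤ |t| * ‖b‖ := by
  refine le_of_tendsto ((hS t a).sub_const a).norm ?_
  filter_upwards [eventually_ne_atTop 0] with n hn
  have hn' : (n : ℝ) ≠ 0 := by exact_mod_cast hn
  refine (h.norm_pow_sub_le hab (t / n) n).trans (le_of_eq ?_)
  rw [abs_div, Nat.abs_cast]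
  field_simp

theorem norm_sub_sub_le (hS : IsExponentialLimit J S)
    (h : IsContractiveResolvent T J) {a b c : E} (hab : (a, b) ∈ T.graph) (hbc : (b, c) ∈ T.graph)
    (t : ℝ) :
    ‖S t a - a - (t : ℂ) • b‖ ≤ t ^ 2 * ‖c‖ := by
  refine le_of_tendsto (((hS t a).sub_const a).sub_const _).norm ?_
  filter_upwards [eventually_ne_atTop 0] with n hn
  have hn' : (n : ℝ) ≠ 0 := by exact_mod_cast hn
  have := h.norm_pow_sub_sub_le hab hbc (t / n) n
  rwa [mul_div_cancel₀ _ hn'] at this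

theorem pow_div (hS : IsExponentialLimit J S)
    (h : IsContractiveResolvent T J) (t : ℝ) {n : ℕ} (hn : n ≠ 0) : S (t / n) ^ n = S t := by
  ext a
  refine tendsto_nhds_unique (tendsto_pow_apply
    (fun k : ℕ => norm_pow_apply_le (h.norm_le (t / n / k)) k) (hS (t / n)) n a) ?_
  -- Along the multiples of `n`, the approximants of `S t` are the `n`-th powers of those of `S (t /
  -- n)`.
  have h1 : Tendsto (fun k : ℕ => k * n) atTop atTop :=
    tendsto_id.atTop_mul_const' (Nat.pos_of_ne_zero hn)
  refine ((hS t a).comp h1).congr fun k => ?_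
  simp only [Function.comp_apply]
  rw [pow_mul, div_div]
  push_cast
  rw [mul_comm (k : ℝ)]

/-- On the domain of `T²`, `S (x + y)` and `S x * S y` agree to second order. At times divided by
`n` the error is `O(n⁻²)`, and the `n`-th power of these commuting contractions leaves `O(n⁻¹)`. -/
theorem add_apply (hS : IsExponentialLimit J S)
    (h : IsContractiveResolvent T J) (t s : ℝ) (a : E) : S (t + s) a = S t (S s a) := by
  have h0 : ∀ a ∈ {a : E | ∃ b c, (a, b) ∈ T.graph ∧ (b, c) ∈ T.graph},
      S (t + s) a = (S t * S s) a := by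
    rintro a ⟨b, c, hab, hbc⟩
    have h1 : ∀ x y : ℝ, ‖S (x + y) a - (S x * S y) a‖ ≤
        ((x + y) ^ 2 + y ^ 2 + |x| * |y| + x ^ 2) * ‖c‖ := by
      intro x y
      have e1 := hS.norm_sub_sub_le h hab hbc (x + y)
      have e2 := (hS.norm_le h x _).trans (hS.norm_sub_sub_le h hab hbc y)
      have e3 : ‖(y : ℂ) • (S x b - b)‖ ≤ |y| * (|x| * ‖c‖) := by
        rw [norm_smul, Complex.norm_real, Real.norm_eq_abs]
        gcongr
        exact hS.norm_sub_le h hbc x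
      have e4 := hS.norm_sub_sub_le h hab hbc x
      have e5 : S (x + y) a - (S x * S y) a = (S (x + y) a - a - ((x + y : ℝ) : ℂ) • b)
          - (S x (S y a - a - (y : ℂ) • b) + (y : ℂ) • (S x b - b)
            + (S x a - a - (x : ℂ) • b)) := by
        simp only [map_sub, map_smul, mul_apply_eq_comp]
        push_cast
        module
      rw [e5]
      refine (_root_.norm_sub_le _ _).trans ?_
      have e6 := norm_add₃_le (a := S x (S y a - a - (y : ℂ) • b)) (b := (y : ℂ) • (S x b - b))
        (c := S x a - a - (x : ℂ) • b)
      linarith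
    have h2 : Tendsto (fun n : ℕ => ((t + s) ^ 2 + s ^ 2 + |t| * |s| + t ^ 2) * ‖c‖ / n) atTop
        (𝓝 0) := tendsto_const_div_atTop_nhds_zero_nat _
    rw [← sub_eq_zero, ← norm_le_zero_iff]
    refine ge_of_tendsto h2 ?_
    filter_upwards [eventually_ne_atTop 0] with n hn
    have hn' : (n : ℝ) ≠ 0 := by exact_mod_cast hn
    have h3 := norm_pow_sub_pow_apply_le (hS.norm_le h (t / n + s / n))
      (Q := S (t / n) * S (s / n))
      (fun a => (hS.norm_le h _ _).trans (hS.norm_le h _ _))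
      ((hS.commute h _ _).mul_right (hS.commute h _ _)) n a
    rw [(hS.commute h _ _).mul_pow, hS.pow_div h t hn, hS.pow_div h s hn, ← add_div,
      hS.pow_div h (t + s) hn, add_div] at h3
    refine h3.trans ((mul_le_mul_of_nonneg_left (h1 _ _) (Nat.cast_nonneg n)).trans (le_of_eq ?_))
    rw [abs_div, abs_div, Nat.abs_cast]
    field_simp
  exact congrFun (Continuous.ext_on h.dense_sq (S (t + s)).continuous (S t * S s).continuous h0) a

theorem continuous_apply (hS : IsExponentialLimit J S)
    (h : IsContractiveResolvent T J) (a : E) : Continuous fun t => S t a := by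
  have h1 : Tendsto (fun t => S t a) (𝓝 0) (𝓝 a) :=
    tendsto_apply_zero_of_graph h.dense (hS.norm_le h)
      (fun _ _ hab t => hS.norm_sub_le h hab t) a
  rw [continuous_iff_continuousAt]
  intro s
  have h2 : Tendsto (fun t => S s (S (t - s) a)) (𝓝 s) (𝓝 (S s a)) := by
    refine ((S s).continuous.tendsto a).comp (h1.comp ?_)
    have : Continuous fun t : ℝ => t - s := by fun_prop
    simpa using this.tendsto s
  refine h2.congr fun t => ?_
  rw [← hS.add_apply h]
  simp

/-- The second-order bound needs `a` in the domain of `T²`, so `a` is replaced by `J s a`. The slope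
of the remainder is at most `‖b - J s b‖` uniformly in `t`, which is small for small `s ≠ 0`. -/
theorem tendsto_slope (hS : IsExponentialLimit J S)
    (h : IsContractiveResolvent T J) {a b : E} (hab : (a, b) ∈ T.graph) :
    Tendsto (fun t : ℝ => (t : ℂ)⁻¹ • (S t a - a)) (𝓝[≠] 0) (𝓝 b) := by
  have hJ : ∀ c, Tendsto (fun s => J s c) (𝓝 0) (𝓝 c) :=
    tendsto_apply_zero_of_graph h.dense h.norm_le
      (fun _ _ hab t => by simpa using h.norm_pow_sub_le hab t 1)
  rw [Metric.tendsto_nhds]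
  intro ε hε
  obtain ⟨s, hs, hs0⟩ := (((Metric.tendsto_nhds.1 (hJ b) (ε / 4) (by positivity)).filter_mono
    nhdsWithin_le_nhds).and (self_mem_nhdsWithin (a := (0 : ℝ)) (s := {0}ᶜ))).exists
  rw [dist_eq_norm] at hs
  obtain ⟨c, hc, -⟩ := h.exists_graph hs0 b
  have hs1 := h.map_graph hab s
  have h2 : Tendsto (fun t : ℝ => |t| * ‖c‖) (𝓝 0) (𝓝 0) := by
    have : Continuous fun t : ℝ => |t| * ‖c‖ := by fun_prop
    simpa using this.tendsto 0
  filter_upwards [(h2.eventually_lt_const (show 0 < ε / 4 by positivity)).filter_mono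
    nhdsWithin_le_nhds, self_mem_nhdsWithin] with t ht ht0
  have ht0' : t ≠ 0 := ht0
  have htc : (t : ℂ) ≠ 0 := by exact_mod_cast ht0'
  have e1 : ‖(t : ℂ)⁻¹ • (S t (a - J s a) - (a - J s a))‖ ≤ ‖b - J s b‖ := by
    rw [norm_smul, norm_inv, Complex.norm_real, Real.norm_eq_abs,
      inv_mul_le_iff₀ (abs_pos.2 ht0')]
    exact hS.norm_sub_le h (T.graph.sub_mem hab hs1) t
  have e2 : ‖(t : ℂ)⁻¹ • (S t (J s a) - J s a - (t : ℂ) • J s b)‖ ≤ |t| * ‖c‖ := by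
    rw [norm_smul, norm_inv, Complex.norm_real, Real.norm_eq_abs,
      inv_mul_le_iff₀ (abs_pos.2 ht0'), ← mul_assoc, ← sq, sq_abs]
    exact hS.norm_sub_sub_le h hs1 hc t
  have e3 : (t : ℂ)⁻¹ • (S t a - a) - b = (t : ℂ)⁻¹ • (S t (a - J s a) - (a - J s a))
      + (t : ℂ)⁻¹ • (S t (J s a) - J s a - (t : ℂ) • J s b) + (J s b - b) := by
    rw [smul_sub _ _ ((t : ℂ) • J s b), inv_smul_smul₀ htc, map_sub]
    module
  rw [dist_eq_norm, e3]
  refine (norm_add₃_le).trans_lt ?_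
  rw [norm_sub_rev] at e1
  linarith

theorem mem_graph_iff_tendsto (hS : IsExponentialLimit J S)
    (h : IsContractiveResolvent T J) (a b : E) : (a, b) ∈ T.graph ↔
    Tendsto (fun t : ℝ => (t : ℂ)⁻¹ • (S t a - a)) (𝓝[≠] 0) (𝓝 b) := by
  refine ⟨hS.tendsto_slope h, fun hb => ?_⟩
  obtain ⟨d, hd, hd'⟩ := h.exists_graph one_ne_zero a
  have h1 := hS.tendsto_slope h hd
  -- `J 1` carries the slopes at `a` to those at `J 1 a`, whose limit is known. Hence `J 1 (a - b) =
  -- a`, which puts `(a, b)` in the graph.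
  have h2 : d = J 1 b := by
    refine tendsto_nhds_unique h1 ((((J 1).continuous.tendsto b).comp hb).congr fun t => ?_)
    have := congrArg (fun T : E →L[ℂ] E => T a) (hS.commute_resolvent h 1 t)
    simp only [mul_apply_eq_comp] at this
    simp [this]
  obtain ⟨c, hc, hc'⟩ := h.exists_graph one_ne_zero (a - b)
  have h3 : J 1 (a - b) = a := by
    rw [map_sub, ← h2]
    simpa using hd'
  rw [h3] at hc hc'
  simp only [Complex.ofReal_one, one_smul] at hc'
  rwa [sub_right_injective hc'] at hc

/-- For `a` in the domain, the derivative at zero of `t ↦ S t a`. -/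
theorem hasDerivAt_zero (hS : IsExponentialLimit J S)
    (h : IsContractiveResolvent T J) {a b : E} (hab : (a, b) ∈ T.graph) : HasDerivAt
    (fun t => S t a) b 0 := by
  rw [hasDerivAt_iff_tendsto_slope_zero]
  refine (hS.tendsto_slope h hab).congr fun t => ?_
  rw [zero_add, hS.zero_apply h, ← Complex.ofReal_inv, Complex.coe_smul]

/-- If `F` has at zero the derivative `T (F 0)`, then `s ↦ S (-s) (F s)` is stationary at zero. -/
theorem hasDerivAt_neg_comp (hS : IsExponentialLimit J S)
    (h : IsContractiveResolvent T J) {F : ℝ → E} {b : E} (hF : HasDerivAt F b 0)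
    (hb : (F 0, b) ∈ T.graph) : HasDerivAt (fun s => S (-s) (F s)) 0 0 := by
  have h1 : HasDerivAt (fun s => S (-s) (F 0)) (-b) 0 := by
    have h2 : HasDerivAt (fun s => S s (F 0)) b (-0) := by
      simpa using hS.hasDerivAt_zero h hb
    simpa [Function.comp_def] using h2.scomp (0 : ℝ) (hasDerivAt_neg (0 : ℝ))
  rw [hasDerivAt_iff_tendsto_slope_zero] at hF h1 ⊢
  have h3 : Tendsto (fun s : ℝ => S (-s) (s⁻¹ • (F (0 + s) - F 0) - b)) (𝓝[≠] 0) (𝓝 0) := by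
    refine squeeze_zero_norm (fun s => hS.norm_le h _ _) ?_
    simpa using (hF.sub_const b).norm
  have h4 : Tendsto (fun s : ℝ => S (-s) b) (𝓝[≠] 0) (𝓝 b) := by
    have := ((hS.continuous_apply h b).comp continuous_neg).tendsto 0
    simp only [Function.comp_apply, neg_zero, hS.zero_apply h] at this
    exact this.mono_left nhdsWithin_le_nhds
  -- The slope splits into `S (-s)` of the error of `F`, the term `S (-s) b`, and the slope of `S
  -- (-s) (F 0)`; the limits are `0`, `b` and `-b`.
  have h5 := (h3.add h4).add h1
  rw [zero_add, add_neg_cancel] at h5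
  refine h5.congr fun s => ?_
  have h6 : ∀ c, S (-s) (s⁻¹ • c) = s⁻¹ • S (-s) c := ((S (-s)).restrictScalars ℝ).map_smul s⁻¹
  simp only [zero_add, neg_zero, hS.zero_apply h, map_sub, h6, smul_sub]
  abel

end IsExponentialLimit

/-! ### Norming functionals and the involution. -/

/-- A functional attaining its norm at `a` has derivative zero along curves that start at `a` and
stay in the ball of radius `‖a‖`. -/
theorem re_apply_deriv_eq_zero {f : StrongDual ℂ E} {u : ℝ → E} {a b : E} (hf : ‖f‖ ≤ 1)
    (hfa : f a = ‖a‖) (hu0 : u 0 = a) (hu : ∀ t, ‖u t‖ ≤ ‖a‖) (hub : HasDerivAt u b 0) :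
    (f b).re = 0 := by
  have h1 : HasDerivAt (fun t => (f (u t)).re) (f b).re 0 :=
    (Complex.reCLM.comp (f.restrictScalars ℝ)).hasFDerivAt.comp_hasDerivAt (0 : ℝ) hub
  refine IsLocalMax.hasDerivAt_eq_zero (Eventually.of_forall fun t => ?_) h1
  simp only [hu0, hfa, Complex.ofReal_re]
  exact (Complex.re_le_norm _).trans ((f.le_of_opNorm_le hf _).trans (by simpa using hu t))

/-- If the generator commutes with the involution on a dense subset of its domain, it does so on the
whole domain. -/
theorem IsExponentialLimit.graph_star [StarAddMonoid E] [StarModule ℂ E] [NormedStarGroup E]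
    {T : E →ₗ.[ℂ] E} {J S : ℝ → E →L[ℂ] E} (hS : IsExponentialLimit J S)
    (h : IsContractiveResolvent T J) {s : Set E} (hs : Dense s)
    (hsT : ∀ z ∈ s, ∃ w, (z, w) ∈ T.graph ∧ (star z, star w) ∈ T.graph)
    {a b c : E} (hab : (a, b) ∈ T.graph) (hac : (star a, c) ∈ T.graph) : c = star b := by
  -- A norming functional at `a` has zero real part on both `b` and `star c`, since each is the
  -- velocity of a curve from `a` inside the ball.
  have h1 : ∀ a b c, (a, b) ∈ T.graph → (star a, c) ∈ T.graph → ‖a‖ ≤ ‖a - (b - star c)‖ := by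
    intro a b c hab hac
    obtain ⟨f, hf, hfa⟩ := exists_dual_vector'' ℂ a
    have e1 : (f b).re = 0 := re_apply_deriv_eq_zero hf hfa (hS.zero_apply h a)
      (fun t => hS.norm_le h t a) (hS.hasDerivAt_zero h hab)
    have e2 : (f (star c)).re = 0 := by
      refine re_apply_deriv_eq_zero (u := fun t => star (S t (star a))) hf hfa ?_ ?_
        (hS.hasDerivAt_zero h hac).star
      · simp [hS.zero_apply h]
      · intro t
        simpa using hS.norm_le h t (star a)
    have e3 : (f (a - (b - star c))).re = ‖a‖ := by simp [e1, e2, hfa]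
    rw [← e3]
    exact (Complex.re_le_norm _).trans ((f.le_of_opNorm_le hf _).trans (by simp))
  -- Subtracting `z` from `a` leaves `b - star c` unchanged, because the two operators agree on `s`.
  have h2 : ∀ z ∈ s, ‖a - z‖ ≤ ‖a - z - (b - star c)‖ := by
    intro z hz
    obtain ⟨w, hw, hw'⟩ := hsT z hz
    have := h1 (a - z) (b - w) (c - star w) (T.graph.sub_mem hab hw)
      (by rw [star_sub]; exact T.graph.sub_mem hac hw')
    simpa using this
  have h3 : ∀ z, ‖a - z‖ ≤ ‖a - z - (b - star c)‖ := fun z =>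
    hs.induction (P := fun z => ‖a - z‖ ≤ ‖a - z - (b - star c)‖) h2
      (isClosed_le (by fun_prop) (by fun_prop)) z
  -- This `z` makes the right side vanish and the left side equal to `‖b - star c‖`.
  have h4 := h3 (a - (b - star c))
  simp only [sub_sub_cancel, sub_self, norm_zero, norm_le_zero_iff] at h4
  rw [sub_eq_zero.1 h4, star_star]

/-- Under the same assumption the group commutes with the involution. -/
theorem IsExponentialLimit.apply_star [StarAddMonoid E] [StarModule ℂ E] [NormedStarGroup E]
    {T : E →ₗ.[ℂ] E} {J S : ℝ → E →L[ℂ] E} (hS : IsExponentialLimit J S)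
    (h : IsContractiveResolvent T J)
    (hT : ∀ a b, (a, b) ∈ T.graph → (star a, star b) ∈ T.graph) (t : ℝ) (a : E) :
    S t (star a) = star (S t a) := by
  have h1 : ∀ t a, J t (star a) = star (J t a) := by
    intro t a
    rcases eq_or_ne t 0 with rfl | ht
    · simp [h.zero_apply]
    obtain ⟨b, hb, hb'⟩ := h.exists_graph ht a
    have := h.eq_apply (hT _ _ hb) t
    rw [← this]
    nth_rewrite 1 [← hb']
    simp
  have h2 : ∀ (t : ℝ) (n : ℕ) a, (J t ^ n) (star a) = star ((J t ^ n) a) := by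
    intro t n
    induction n with
    | zero => intro a; simp
    | succ n ih =>
      intro a
      rw [pow_succ, mul_apply_eq_comp, h1, ih]
      rfl
  refine tendsto_nhds_unique (hS t (star a)) ?_
  simpa only [h2] using (hS t a).star

end Generation

/-! ### Weak products: closedness, uniqueness, continuity. -/

namespace BanachQuasiStarAlgebra

variable {A₀ A : Type*}
  [NonUnitalRing A₀] [Module ℂ A₀] [IsScalarTower ℂ A₀ A₀] [SMulCommClass ℂ A₀ A₀]
  [StarRing A₀] [StarModule ℂ A₀]
  [NormedAddCommGroup A] [NormedSpace ℂ A] [CompleteSpace A]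
  [StarAddMonoid A] [StarModule ℂ A] [NormedStarGroup A]

theorem continuous_form {Q : BanachQuasiStarAlgebra A₀ A} {φ : A →ₗ[ℂ] A →ₗ⋆[ℂ] ℂ}
    (hφ : φ ∈ Q.forms) : Continuous fun p : A × A => φ p.1 p.2 := by
  refine continuous_iff_continuousAt.2 fun p => tendsto_iff_norm_sub_tendsto_zero.2 ?_
  have h1 : Continuous fun q : A × A => ‖q.1 - p.1‖ * ‖q.2‖ + ‖p.1‖ * ‖q.2 - p.2‖ := by fun_prop
  have h2 := h1.tendsto p
  simp only [sub_self, norm_zero, zero_mul, mul_zero, add_zero] at h2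
  refine squeeze_zero (fun _ => norm_nonneg _) (fun q => ?_) h2
  have h3 : φ q.1 q.2 - φ p.1 p.2 = φ (q.1 - p.1) q.2 + φ p.1 (q.2 - p.2) := by
    simp only [map_sub, LinearMap.sub_apply]
    ring
  rw [h3]
  exact (norm_add_le _ _).trans (add_le_add (hφ.2.2 _ _) (hφ.2.2 _ _))

/-- This lets weak products pass to norm limits in both factors and the product at once. -/
theorem isClosed_isWeakMul (Q : BanachQuasiStarAlgebra A₀ A) :
    IsClosed {p : A × A × A | Q.IsWeakMul p.1 p.2.1 p.2.2} := by
  simp only [IsWeakMul, Set.ofPred_forall]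
  refine isClosed_iInter fun φ => isClosed_iInter fun hφ => isClosed_iInter fun x =>
    isClosed_iInter fun y => isClosed_eq ?_ ?_
  · exact (continuous_form hφ).comp (((Q.continuous_rmul x).comp continuous_snd.fst).prodMk
      ((Q.continuous_rmul y).comp continuous_fst.star))
  · exact (continuous_form hφ).comp (((Q.continuous_rmul x).comp continuous_snd.snd).prodMk
      continuous_const)

theorem IsWeakMul.of_tendsto {Q : BanachQuasiStarAlgebra A₀ A} {ι : Type*} {l : Filter ι} [l.NeBot]
    {f g k : ι → A} {a b c : A} (hf : Tendsto f l (𝓝 a)) (hg : Tendsto g l (𝓝 b))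
    (hk : Tendsto k l (𝓝 c)) (h : ∀ i, Q.IsWeakMul (f i) (g i) (k i)) : Q.IsWeakMul a b c :=
  Q.isClosed_isWeakMul.mem_of_tendsto (hf.prodMk_nhds (hg.prodMk_nhds hk)) (Eventually.of_forall h)

theorem IsWeakMul.add_right {Q : BanachQuasiStarAlgebra A₀ A} {a b b' c c' : A}
    (h : Q.IsWeakMul a b c) (h' : Q.IsWeakMul a b' c') : Q.IsWeakMul a (b + b') (c + c') := by
  intro φ hφ x y
  simp [h φ hφ x y, h' φ hφ x y]

theorem IsWeakMul.smul_right {Q : BanachQuasiStarAlgebra A₀ A} {a b c : A} (z : ℂ)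
    (h : Q.IsWeakMul a b c) : Q.IsWeakMul a (z • b) (z • c) := by
  intro φ hφ x y
  simp [h φ hφ x y]

theorem IsWeakMul.add_left {Q : BanachQuasiStarAlgebra A₀ A} {a a' b c c' : A}
    (h : Q.IsWeakMul a b c) (h' : Q.IsWeakMul a' b c') : Q.IsWeakMul (a + a') b (c + c') := by
  intro φ hφ x y
  simp [h φ hφ x y, h' φ hφ x y]

theorem IsWeakMul.smul_left {Q : BanachQuasiStarAlgebra A₀ A} {a b c : A} (z : ℂ)
    (h : Q.IsWeakMul a b c) : Q.IsWeakMul (z • a) b (z • c) := by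
  intro φ hφ x y
  simp [h φ hφ x y]

theorem isWeakMul_incl (Q : BanachQuasiStarAlgebra A₀ A) (a : A) (x : A₀) :
    Q.IsWeakMul a (Q.incl x) (Q.rmul a x) := by
  intro φ hφ u v
  rw [Q.rmul_incl, ← hφ.2.1, Q.rmul_mul]

/-- If `A₀` is a core for the weak left multiplication by zero, the forms separate points. -/
theorem IsCoreForLeftMul.eq_of_forms {Q : BanachQuasiStarAlgebra A₀ A} (h : Q.IsCoreForLeftMul 0)
    {c d : A} (hcd : ∀ φ ∈ Q.forms, ∀ x y : A₀,
      φ (Q.rmul c x) (Q.incl y) = φ (Q.rmul d x) (Q.incl y)) : c = d := by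
  -- Here `c - d` is a weak product of `0` and `0`, while the closure of the graph of `x ↦ 0 x` only
  -- contains pairs with second entry `0`.
  have h1 : ((0 : A), c - d) ∈ Q.weakLeftMulGraph 0 := by
    intro φ hφ x y
    simp [hcd φ hφ x y]
  rw [h] at h1
  have h2 : closure (Q.leftMulGraph 0) ⊆ {p : A × A | p.2 = 0} := by
    refine closure_minimal ?_ (isClosed_eq continuous_snd continuous_const)
    rintro _ ⟨x, rfl⟩
    simp
  exact sub_eq_zero.1 (h2 h1)

theorem IsWeakMul.unique {Q : BanachQuasiStarAlgebra A₀ A} (h : Q.IsCoreForLeftMul 0)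
    {a b c d : A} (hc : Q.IsWeakMul a b c) (hd : Q.IsWeakMul a b d) : c = d :=
  h.eq_of_forms fun φ hφ x y => (hc φ hφ x y).symm.trans (hd φ hφ x y)

/-- The product is the extension of `x ↦ a x` by continuity from the dense `A₀`. -/
theorem IsBoundedElement.exists_isWeakMul {Q : BanachQuasiStarAlgebra A₀ A} {a : A}
    (ha : Q.IsBoundedElement a) (b : A) : ∃ c, Q.IsWeakMul a b c := by
  obtain ⟨⟨C, hC⟩, -⟩ := ha
  obtain ⟨f, hf, hfb⟩ := mem_closure_iff_seq_limit.1 (Q.dense_incl b)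
  choose u hu using hf
  have h1 : CauchySeq fun n => Q.rmul a (u n) := by
    have h2 := Metric.cauchySeq_iff'.1 hfb.cauchySeq
    rw [Metric.cauchySeq_iff']
    intro ε hε
    obtain ⟨N, hN⟩ := h2 (ε / (|C| + 1)) (by positivity)
    refine ⟨N, fun n hn => ?_⟩
    have h3 := hN n hn
    rw [lt_div_iff₀ (by positivity)] at h3
    rw [dist_eq_norm] at h3 ⊢
    rw [← map_sub]
    have h4 := hC (u n - u N)
    rw [map_sub, map_sub, hu, hu] at h4
    rw [map_sub]
    nlinarith [norm_nonneg (f n - f N), le_abs_self C]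
  obtain ⟨c, hc⟩ := cauchySeq_tendsto_of_complete h1
  refine ⟨c, IsWeakMul.of_tendsto tendsto_const_nhds hfb hc fun n => ?_⟩
  rw [← hu]
  exact Q.isWeakMul_incl a (u n)

/-- Weak left multiplication by elements that depend linearly and continuously on a parameter and
that can be multiplied by everything is jointly continuous, by the closed graph theorem. -/
theorem exists_bilinear_isWeakMul {Q : BanachQuasiStarAlgebra A₀ A} (h : Q.IsCoreForLeftMul 0)
    (R : A →L[ℂ] A) (hR : ∀ u b, ∃ c, Q.IsWeakMul (R u) b c) :
    ∃ B : A →L[ℂ] A →L[ℂ] A, ∀ u b, Q.IsWeakMul (R u) b (B u b) := by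
  choose m hm using hR
  let L : A → A →L[ℂ] A := fun u => ContinuousLinearMap.ofSeqClosedGraph
    (g :=
      { toFun := m u
        map_add' := fun b b' => (hm u (b + b')).unique h ((hm u b).add_right (hm u b'))
        map_smul' := fun z b => (hm u (z • b)).unique h ((hm u b).smul_right z) })
    fun f x y hf hg => (IsWeakMul.of_tendsto tendsto_const_nhds hf hg fun n => hm u (f n)).unique h
      (hm u x)
  have hL : ∀ u b, Q.IsWeakMul (R u) b (L u b) := fun u b => hm u b
  -- The closed graph theorem again, now for `u ↦ L u` with values in the bounded operators.
  refine ⟨ContinuousLinearMap.ofSeqClosedGraph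
    (g :=
      { toFun := L
        map_add' := fun u u' => ?_
        map_smul' := fun z u => ?_ }) fun f x y hf hg => ?_, fun u b => hL u b⟩
  · ext b
    refine (hL (u + u') b).unique h ?_
    rw [map_add]
    exact (hL u b).add_left (hL u' b)
  · ext b
    refine (hL (z • u) b).unique h ?_
    rw [map_smul]
    exact (hL u b).smul_left z
  · ext b
    refine IsWeakMul.unique h (IsWeakMul.of_tendsto ((R.continuous.tendsto x).comp hf)
      tendsto_const_nhds ?_ fun n => hL (f n) b) (hL x b)
    exact ((ContinuousLinearMap.apply ℂ A b).continuous.tendsto y).comp hg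

/-! ### From the Leibniz rule to multiplicativity of the group. -/

section Derivation

variable {Q : BanachQuasiStarAlgebra A₀ A} {δ : A →ₗ.[ℂ] A} {J S : ℝ → A →L[ℂ] A}
  {B : A →L[ℂ] A →L[ℂ] A}

/-- The Leibniz rule for the bilinear map `(u, b) ↦ (J 1 u) □ b`. -/
theorem IsWeakStarDerivation.graph_bilinear (hδ : Q.IsWeakStarDerivation δ)
    (h0 : Q.IsCoreForLeftMul 0) (hJ : IsContractiveResolvent δ J)
    (hB : ∀ u b, Q.IsWeakMul (J 1 u) b (B u b)) {u v b d : A} (hu : (u, v) ∈ δ.graph)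
    (hb : (b, d) ∈ δ.graph) : (B u b, B u d + B v b) ∈ δ.graph := by
  obtain ⟨a, ha, ha'⟩ := δ.mem_graph_iff.1 (hJ.map_graph hu 1)
  obtain ⟨b', hb1, hb2⟩ := δ.mem_graph_iff.1 hb
  simp only at ha ha' hb1 hb2
  obtain ⟨hc, hc'⟩ := hδ.leibniz a b' (B u b) (by rw [ha, hb1]; exact hB u b)
  have h1 : δ ⟨B u b, hc⟩ = B u d + B v b := by
    refine h0.eq_of_forms fun φ hφ x y => ?_
    rw [hc' φ hφ x y, ha, ha', hb1, hb2, hB v b φ hφ x y, hB u d φ hφ x y]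
    simp [add_comm]
  rw [← h1]
  exact δ.mem_graph ⟨B u b, hc⟩

theorem IsWeakStarDerivation.apply_bilinear (hδ : Q.IsWeakStarDerivation δ)
    (h0 : Q.IsCoreForLeftMul 0) (hJ : IsContractiveResolvent δ J) (hS : IsExponentialLimit J S)
    (hB : ∀ u b, Q.IsWeakMul (J 1 u) b (B u b)) {u v b d : A} (hu : (u, v) ∈ δ.graph)
    (hb : (b, d) ∈ δ.graph) (t : ℝ) : S t (B u b) = B (S t u) (S t b) := by
  have h1 : ∀ {u v b d : A}, (u, v) ∈ δ.graph → (b, d) ∈ δ.graph →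
      HasDerivAt (fun s => S (-s) (B (S s u) (S s b))) 0 0 := by
    intro u v b d hu hb
    have h2 : HasDerivAt (fun s => B (S s u) (S s b)) (B u d + B v b) 0 := by
      have := (B.bilinearRestrictScalars ℝ).hasDerivAt_of_bilinear
        (fun _ => hS.hasDerivAt_zero hJ hu) (fun _ => hS.hasDerivAt_zero hJ hb)
      simpa [hS.zero_apply hJ] using this
    refine hS.hasDerivAt_neg_comp hJ h2 ?_
    simpa only [hS.zero_apply hJ] using hδ.graph_bilinear h0 hJ hB hu hb
  -- The derivative at `s` reduces to the one at zero for `S s u` and `S s b`, which stay in the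
  -- domain; the group law shifts the time.
  have h3 : ∀ s, HasDerivAt (fun s => S (-s) (B (S s u) (S s b))) 0 s := by
    intro s
    have h4 := h1 (hS.map_graph hJ hu s) (hS.map_graph hJ hb s)
    rw [← sub_self s] at h4
    have h5 := ((S (-s)).restrictScalars ℝ).hasFDerivAt.comp_hasDerivAt s (h4.comp_sub_const s s)
    rw [map_zero] at h5
    refine h5.congr_of_eventuallyEq (Eventually.of_forall fun r => ?_)
    simp only [Function.comp_apply, ContinuousLinearMap.coe_restrictScalars',
      ← hS.add_apply hJ]
    congr 2
    · ring_nf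
    · simp
    all_goals simp
  have h6 := is_const_of_deriv_eq_zero (fun s => (h3 s).differentiableAt) (fun s =>
  (h3 s).deriv) 0 t
  simp only [neg_zero, hS.zero_apply hJ] at h6
  rw [h6, ← hS.add_apply hJ, add_neg_cancel, hS.zero_apply hJ]

/-- For `a` in the domain of `δ²`, `a = J 1 (a - δ a)` with `a - δ a` in the domain, as
`apply_bilinear` requires. Density and closedness give the rest. -/
theorem IsWeakStarDerivation.isWeakMul_apply_incl (hδ : Q.IsWeakStarDerivation δ)
    (hbdd : ∀ a ∈ δ.domain, Q.IsBoundedElement a) (h0 : Q.IsCoreForLeftMul 0)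
    (hJ : IsContractiveResolvent δ J) (hS : IsExponentialLimit J S) (t : ℝ) (a : A) (x : A₀) :
    Q.IsWeakMul (S t a) (S t (Q.incl x)) (S t (Q.rmul a x)) := by
  obtain ⟨B, hB⟩ := exists_bilinear_isWeakMul h0 (J 1) fun u b =>
    (hbdd _ ((hJ.isBoundedInverse 1 one_ne_zero).1 u).1).exists_isWeakMul b
  refine hJ.dense_sq.induction (P := fun a =>
    Q.IsWeakMul (S t a) (S t (Q.incl x)) (S t (Q.rmul a x))) ?_ ?_ a
  · rintro a ⟨b, c, hab, hbc⟩
    have h1 : J 1 (a - b) = a := by simpa using hJ.eq_apply hab 1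
    have h2 : B (a - b) (Q.incl x) = Q.rmul a x := by
      refine (hB (a - b) (Q.incl x)).unique h0 ?_
      rw [h1]
      exact Q.isWeakMul_incl a x
    have h3 := hδ.apply_bilinear h0 hJ hS hB (δ.graph.sub_mem hab hbc)
      (δ.mem_graph ⟨Q.incl x, hδ.incl_mem x⟩) t
    simp only [h2] at h3
    have h4 : J 1 (S t (a - b)) = S t a := by
      have := congrArg (fun T : A →L[ℂ] A => T (a - b)) (hS.commute_resolvent hJ 1 t)
      simp only [mul_apply_eq_comp, h1] at this
      exact this
    rw [h3, ← h4]
    exact hB _ _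
  · exact Q.isClosed_isWeakMul.preimage ((S t).continuous.prodMk
      (continuous_const.prodMk ((S t).continuous.comp (Q.continuous_rmul x))))

theorem IsWeakStarDerivation.isWeakMul_apply (hδ : Q.IsWeakStarDerivation δ)
    (hbdd : ∀ a ∈ δ.domain, Q.IsBoundedElement a) (hcore : ∀ a : A, Q.IsCoreForLeftMul a)
    (hJ : IsContractiveResolvent δ J) (hS : IsExponentialLimit J S) (t : ℝ) {a b c : A}
    (habc : Q.IsWeakMul a b c) : Q.IsWeakMul (S t a) (S t b) (S t c) := by
  have h1 : (b, c) ∈ closure (Q.leftMulGraph a) := by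
    rw [← hcore a]
    exact habc
  have h2 : closure (Q.leftMulGraph a) ⊆ {p : A × A | Q.IsWeakMul (S t a) (S t p.1) (S t p.2)} := by
    refine closure_minimal ?_ (Q.isClosed_isWeakMul.preimage (continuous_const.prodMk
      (((S t).continuous.comp continuous_fst).prodMk ((S t).continuous.comp continuous_snd))))
    rintro _ ⟨x, rfl⟩
    exact hδ.isWeakMul_apply_incl hbdd (hcore 0) hJ hS t a x
  exact h2 h1

theorem IsWeakStarDerivation.graph_star (hδ : Q.IsWeakStarDerivation δ)
    (hJ : IsContractiveResolvent δ J) (hS : IsExponentialLimit J S) {a b : A}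
    (hab : (a, b) ∈ δ.graph) : (star a, star b) ∈ δ.graph := by
  have h1 := δ.mem_graph ⟨star a, hδ.star_mem a (LinearPMap.mem_domain_of_mem_graph hab)⟩
  have h2 := hS.graph_star hJ (s := Set.range Q.incl) Q.dense_incl ?_ hab h1
  · rwa [← h2]
  · rintro _ ⟨x, rfl⟩
    refine ⟨_, δ.mem_graph ⟨Q.incl x, hδ.incl_mem x⟩, ?_⟩
    rw [← hδ.map_star, ← Q.incl_star]
    exact δ.mem_graph ⟨Q.incl (star x), hδ.incl_mem (star x)⟩

end Derivation

end BanachQuasiStarAlgebra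

/-! ### Assembly of the group from the hypotheses. -/

/-- A densely defined operator with the nonzero reals in the resolvent set and the lower bound of a
generator of isometries has a contractive resolvent. -/
theorem exists_isContractiveResolvent {E : Type*} [NormedAddCommGroup E] [NormedSpace ℂ E]
    {T : E →ₗ.[ℂ] E} (hT : Dense (T.domain : Set E))
    (hres : ∀ r : ℝ, r ≠ 0 → (r : ℂ) ∈ operatorResolventSet T)
    (hlow : ∀ (r : ℝ) (a : T.domain), |r| * ‖(a : E)‖ ≤ ‖T a - (r : ℂ) • (a : E)‖) :
    ∃ J, IsContractiveResolvent T J := by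
  have h1 : ∀ t : ℝ, ∃ R : E →L[ℂ] E, (t ≠ 0 → IsBoundedInverse T 1 (t : ℂ) R) ∧
      (∀ a, ‖R a‖ ≤ ‖a‖) ∧ (t = 0 → ∀ a, R a = a) := by
    intro t
    rcases eq_or_ne t 0 with rfl | ht
    · exact ⟨1, fun h => (h rfl).elim, fun a => le_rfl, fun _ a => rfl⟩
    obtain ⟨R, hR1, hR2⟩ := hres t⁻¹ (inv_ne_zero ht)
    have htc : (t : ℂ) ≠ 0 := by exact_mod_cast ht
    -- `(1 - t T)⁻¹ = t⁻¹ (t⁻¹ - T)⁻¹`, and the lower bound at `t⁻¹` says exactly that this is a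
    -- contraction.
    refine ⟨((t⁻¹ : ℝ) : ℂ) • R, fun _ => ⟨fun a => ?_, fun a => ?_⟩, fun a => ?_,
      fun h => (ht h).elim⟩
    · obtain ⟨h, ha⟩ := hR1 a
      refine ⟨T.domain.smul_mem _ h, ?_⟩
      have h2 := T.map_smul ((t⁻¹ : ℝ) : ℂ) ⟨R a, h⟩
      change (1 : ℂ) • ((t⁻¹ : ℝ) : ℂ) • R a - (t : ℂ) • T (((t⁻¹ : ℝ) : ℂ) • ⟨R a, h⟩) = a
      rw [h2, one_smul, Complex.ofReal_inv, smul_inv_smul₀ htc]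
      simpa using ha
    · have h2 := hR2 a
      change ((t⁻¹ : ℝ) : ℂ) • R ((1 : ℂ) • (a : E) - (t : ℂ) • T a) = a
      rw [← map_smul, smul_sub, one_smul, Complex.ofReal_inv, inv_smul_smul₀ htc]
      simpa using h2
    · obtain ⟨h, ha⟩ := hR1 a
      have h2 := hlow t⁻¹ ⟨R a, h⟩
      rw [one_smul] at ha
      rw [norm_sub_rev, ha] at h2
      change ‖((t⁻¹ : ℝ) : ℂ) • R a‖ ≤ ‖a‖
      rwa [norm_smul, Complex.norm_real, Real.norm_eq_abs]
  choose J hJ1 hJ2 hJ3 using h1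
  exact ⟨J, hJ1, hJ2, hT, hJ3 0 rfl⟩

theorem theorem5p3 {A₀ A : Type*}
    [NonUnitalRing A₀] [Module ℂ A₀] [IsScalarTower ℂ A₀ A₀] [SMulCommClass ℂ A₀ A₀]
    [StarRing A₀] [StarModule ℂ A₀]
    [NormedAddCommGroup A] [NormedSpace ℂ A] [CompleteSpace A]
    [StarAddMonoid A] [StarModule ℂ A] [NormedStarGroup A]
    (Q : BanachQuasiStarAlgebra A₀ A) (hQ : Q.StarSemisimple)
    (δ : A →ₗ.[ℂ] A) (hδ : Q.IsWeakStarDerivation δ) (hclosed : δ.IsClosed)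
    (hbdd : ∀ a ∈ δ.domain, Q.IsBoundedElement a)
    (hres : ∀ r : ℝ, r ≠ 0 → (r : ℂ) ∈ operatorResolventSet δ)
    (hlow : ∀ (r : ℝ) (a : δ.domain), |r| * ‖(a : A)‖ ≤ ‖δ a - (r : ℂ) • (a : A)‖)
    (hcore : ∀ a : A, Q.IsCoreForLeftMul a) :
    ∃ β : ℝ → A ≃ₗ[ℂ] A,
      Q.IsWeakStarAutomorphismGroup β ∧
      (∃ M : ℝ, ∀ t a, ‖β t a‖ ≤ M * ‖a‖) ∧
      (∀ a, Continuous fun t => β t a) ∧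
      IsInfinitesimalGenerator δ β ∧
      ∀ t : ℝ, t ≠ 0 → ∃ J : ℕ → A →L[ℂ] A,
        (∀ n : ℕ, 1 ≤ n → IsBoundedInverse δ 1 ((t : ℂ) / (n : ℂ)) (J n)) ∧
        ∀ a, Tendsto (fun n => (J n ^ n) a) atTop (𝓝 (β t a)) := by

  have hdense : Dense (δ.domain : Set A) :=
    Q.dense_incl.mono (Set.range_subset_iff.2 hδ.incl_mem)
  obtain ⟨J, hJ⟩ := exists_isContractiveResolvent hdense hres hlow
  obtain ⟨S, hS⟩ := hJ.exists_isExponentialLimit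
  have hinv : ∀ t a, S (-t) (S t a) = a := by
    intro t a
    rw [← hS.add_apply hJ, neg_add_cancel, hS.zero_apply hJ]
  have hinv' : ∀ t a, S t (S (-t) a) = a := by
    intro t a
    rw [← hS.add_apply hJ, add_neg_cancel, hS.zero_apply hJ]
  let β : ℝ → A ≃ₗ[ℂ] A := fun t =>
    LinearEquiv.ofLinearMap (S t : A →ₗ[ℂ] A) (S (-t) : A →ₗ[ℂ] A)
      (LinearMap.ext (hinv' t)) (LinearMap.ext (hinv t))
  have hmul : ∀ t a b c, Q.IsWeakMul a b c → Q.IsWeakMul (S t a) (S t b) (S t c) :=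
    fun t a b c => hδ.isWeakMul_apply hbdd hcore hJ hS t
  refine ⟨β, ⟨fun t => ⟨?_, fun a b => ⟨?_, ?_⟩, hmul t⟩, hS.zero_apply hJ, hS.add_apply hJ⟩,
    ⟨1, fun t a => ?_⟩, hS.continuous_apply hJ, fun a b => ?_,
    fun t ht => ⟨fun n => J (t / n), fun n hn => ?_, hS t⟩⟩
  · exact hS.apply_star hJ (fun a b => hδ.graph_star hJ hS) t
  -- Multiplicativity of the inverse `S (-t)` brings the product back.
  · rintro ⟨c, hc⟩
    have h1 := hmul (-t) _ _ _ hc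
    exact ⟨S (-t) c, by simpa only [β, LinearEquiv.coe_ofLinearMap, ContinuousLinearMap.coe_coe,
      hinv] using h1⟩
  · rintro ⟨c, hc⟩
    exact ⟨S t c, hmul t _ _ _ hc⟩
  · rw [one_mul]
    exact hS.norm_le hJ t a
  · refine Iff.trans ?_ (hS.mem_graph_iff_tendsto hJ a b)
    constructor
    · rintro ⟨h, rfl⟩
      exact δ.mem_graph ⟨a, h⟩
    · intro h
      obtain ⟨y, rfl, rfl⟩ := δ.mem_graph_iff.1 h
      exact ⟨y.2, rfl⟩
  · have hn' : (n : ℝ) ≠ 0 := by exact_mod_cast Nat.one_le_iff_ne_zero.1 hn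
    have h1 := hJ.isBoundedInverse (t / n) (div_ne_zero ht hn')
    rwa [Complex.ofReal_div, Complex.ofReal_natCast] at h1
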